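/- Let $k\ge 1$ and $q\ge 0$, and let $M$ be a compact (Hausdorff) complex foliated manifold with leaves of complex dimension $k$ and real codimension $q$: $M$ has an atlas of charts with values in $\mathbb{C}^k\times\mathbb{R}^q$ whose transition maps are smooth and locally of the form $(z,t)\mapsto (f(z,t),g(t))$ with $f$ holomorphic in $z$. Let $F\subset TM$ be the bundle of vectors tangent to the leaves, with its complex structure $J$, and let $\mathrm{d}_\tau$ and $\bar\partial_\tau$ be the leafwise de Rham and Dolbeault operators; "tangentially smooth" means smooth along the leaves with all leafwise derivatives continuous on $M$. Suppose that $M$ is Kähler, i.e. it carries a tangentially smooth, $\mathrm{d}_\tau$-closed, positive definite real $(1,1)$-form on $F$. Let $E\to M$ be a tangential holomorphic line bundle, i.e. a complex line bundle whose transition functions are tangentially smooth and holomorphic along the leaves, and suppose that $E$ is negative: there is a tangentially smooth Hermitian metric on $E$ such that the curvature $\Theta$ of its tangential Chern connection (the connection along $F$ that is compatible with the metric and has $(0,1)$-part $\bar\partial_\tau$) is such that $-\sqrt{-1}\,\Theta$ is positive definite, i.e. $-\sqrt{-1}\,\Theta(v,Jv)>0$ for all $0\ne v\in F$. Then $E$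 has no nonzero $\bar\partial_\tau$-holomorphic section: every tangentially smooth section $s$ of $E$ over $M$ with $\bar\partial_\tau s=0$ vanishes identically. -/

import Mathlib

open Set Topology Bundle
open scoped Manifold ContDiff

noncomputable section

namespace TangentialGeometry

/-! ### Complex foliated manifolds -/

/-- The local model of a foliation by complex `k`-dimensional leaves of real codimension `q`:
points are pairs `(z, t)`, and the plaques are the slices `t = const`. -/
abbrev Model (k q : ℕ) : Type := EuclideanSpace ℂ (Fin k) × EuclideanSpace ℝ (Fin q)

/-- A map between open subsets of the model is an admissible change of foliated coordinates if it
is smooth and its differential maps the plaque directions into the plaque directions by a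
`ℂ`-linear map. Equivalently, it is locally of the form `(z, t) ↦ (f (z, t), g t)` with `f` and `g`
smooth and `f` holomorphic in `z`. -/
def complexFoliationPregroupoid (k q : ℕ) : Pregroupoid (Model k q) where
  property f u := ContDiffOn ℝ ∞ f u ∧ ∀ p ∈ u,
    ∃ A : EuclideanSpace ℂ (Fin k) →L[ℂ] EuclideanSpace ℂ (Fin k),
      ∀ v : EuclideanSpace ℂ (Fin k), fderiv ℝ f p (v, 0) = (A v, 0)
  comp := by
    rintro f g u v ⟨hf, hf'⟩ ⟨hg, hg'⟩ hu hv huv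
    refine ⟨hg.comp_inter hf, fun p hp => ?_⟩
    obtain ⟨A, hA⟩ := hf' p hp.1
    obtain ⟨B, hB⟩ := hg' (f p) hp.2
    refine ⟨B.comp A, fun w => ?_⟩
    have h1 : DifferentiableAt ℝ f p :=
      ((hf.contDiffAt (hu.mem_nhds hp.1)).differentiableAt (by simp))
    have h2 : DifferentiableAt ℝ g (f p) :=
      ((hg.contDiffAt (hv.mem_nhds hp.2)).differentiableAt (by simp))
    rw [fderiv_comp p h2 h1]
    simp [hA, hB]
  id_mem := ⟨contDiffOn_id, fun p _ => ⟨ContinuousLinearMap.id ℂ _, fun v => by simp⟩⟩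
  locality := by
    intro f u _ h
    refine ⟨fun p hp => ?_, fun p hp => ?_⟩
    · obtain ⟨v, hv, hpv, hf, -⟩ := h p hp
      exact (hf p ⟨hp, hpv⟩).mono_of_mem_nhdsWithin
        (Filter.inter_mem self_mem_nhdsWithin (mem_nhdsWithin_of_mem_nhds (hv.mem_nhds hpv)))
    · obtain ⟨v, -, hpv, -, hf⟩ := h p hp
      exact hf p ⟨hp, hpv⟩
  congr := by
    rintro f g u hu hfg ⟨hf, hf'⟩
    refine ⟨hf.congr hfg, fun p hp => ?_⟩
    obtain ⟨A, hA⟩ := hf' p hp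
    have : g =ᶠ[𝓝 p] f := Filter.eventuallyEq_of_mem (hu.mem_nhds hp) hfg
    exact ⟨A, fun v => by rw [this.fderiv_eq, hA]⟩

/-- The groupoid of changes of foliated coordinates. A complex foliated manifold is a space with an
atlas of charts to `Model k q` whose transition maps belong to this groupoid. -/
def complexFoliationGroupoid (k q : ℕ) : StructureGroupoid (Model k q) :=
  (complexFoliationPregroupoid k q).groupoid

/-- The fibre at `x` of the foliation bundle `F ⊆ TM`, i.e. the tangent space at `x` of the leaf
through `x`. As for `TangentSpace`, it is identified with the model space by means of the preferred
chart at `x`. Its complex structure `J` is multiplication by `Complex.I`. -/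
abbrev FoliationBundle (k : ℕ) {M : Type*} (_ : M) : Type := EuclideanSpace ℂ (Fin k)

/-- A function `(z, t) ↦ g (z, t)` on an open subset `W` of the model is tangentially smooth if it
is smooth in `z` and all its derivatives in the `z`-directions (in particular `g` itself) are
continuous in `(z, t)`. -/
def SliceSmoothOn (k q : ℕ) {V : Type*} [NormedAddCommGroup V] [NormedSpace ℝ V]
    (g : Model k q → V) (W : Set (Model k q)) : Prop :=
  (∀ p ∈ W, ContDiffAt ℝ ∞ (fun z => g (z, p.2)) p.1) ∧
  ∀ m : ℕ, ContinuousOn (fun p : Model k q => iteratedFDeriv ℝ m (fun z => g (z, p.2)) p.1) W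

section Manifold

variable (k q : ℕ) {M : Type*} [TopologicalSpace M] [ChartedSpace (Model k q) M]

/-- A function on `M` is tangentially smooth on the open set `U`. -/
def TSmoothOn {V : Type*} [NormedAddCommGroup V] [NormedSpace ℝ V] (f : M → V) (U : Set M) : Prop :=
  ∀ φ ∈ atlas (Model k q) M, SliceSmoothOn k q (f ∘ φ.symm) (φ.target ∩ φ.symm ⁻¹' U)

/-- The tangential de Rham differential `d_τ f` at `x`: the differential at `x` of the restriction
of `f` to the leaf through `x`. -/
def leafDeriv {V : Type*} [NormedAddCommGroup V] [NormedSpace ℝ V] (f : M → V) (x : M) :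
    FoliationBundle k x →L[ℝ] V :=
  fderiv ℝ (fun z => f ((chartAt (Model k q) x).symm (z, (chartAt (Model k q) x x).2)))
    (chartAt (Model k q) x x).1

/-- The differential at `y` of the leaf coordinate `z` of a foliated chart `φ`: it expresses a
vector tangent to the leaf at `y` in the coordinates of `φ`. -/
def leafCoord (φ : OpenPartialHomeomorph M (Model k q)) (y : M) :
    FoliationBundle k y →L[ℂ] EuclideanSpace ℂ (Fin k) :=
  fderiv ℂ (fun z =>
      (φ ((chartAt (Model k q) y).symm (z, (chartAt (Model k q) y y).2))).1)
    (chartAt (Model k q) y y).1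

/-- A section of the foliation bundle is tangentially smooth on the open set `U` if its components
in all foliated charts are. -/
def TSmoothVectorFieldOn (X : ∀ x : M, FoliationBundle k x) (U : Set M) : Prop :=
  ∀ φ ∈ atlas (Model k q) M,
    SliceSmoothOn k q (fun p => leafCoord k q φ (φ.symm p) (X (φ.symm p)))
      (φ.target ∩ φ.symm ⁻¹' U)

/-- The Lie bracket of two vector fields tangent to the leaves, computed along the leaf through `x`
in the preferred chart at `x`. -/
def leafBracket (X Y : ∀ x : M, FoliationBundle k x) (x : M) : FoliationBundle k x :=
  leafDeriv k q (fun y => leafCoord k q (chartAt (Model k q) x) y (Y y)) x (X x) -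
    leafDeriv k q (fun y => leafCoord k q (chartAt (Model k q) x) y (X y)) x (Y x)

end Manifold

/-- The `(0,1)`-part of a real-linear map `α` from a complex vector space to another one, i.e. of a
complex 1-form (possibly with values in a complex vector space). -/
def zeroOnePart {V W : Type*} [AddCommGroup V] [Module ℂ V] [AddCommGroup W] [Module ℂ W]
    (α : V →ₗ[ℝ] W) (v : V) : W :=
  (1 / 2 : ℂ) • (α v + Complex.I • α (Complex.I • v))

/-! ### Tangential 2-forms and Kähler foliated manifolds -/

/-- Complex valued tangential 2-forms (with no regularity). -/
abbrev TwoForm (k : ℕ) (M : Type*) : Type _ :=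
  ∀ x : M, FoliationBundle k x [⋀^Fin 2]→L[ℝ] ℂ

/-- A tangential 2-form is a positive definite real form of type `(1,1)`. -/
def IsPositiveOneOne {k : ℕ} {M : Type*} (η : TwoForm k M) : Prop :=
  ∀ x : M,
    (∀ v w : FoliationBundle k x, η x ![Complex.I • v, Complex.I • w] = η x ![v, w]) ∧
    (∀ v w : FoliationBundle k x, (η x ![v, w]).im = 0) ∧
    ∀ v : FoliationBundle k x, v ≠ 0 → 0 < (η x ![v, Complex.I • v]).re

section Kahler

variable (k q : ℕ) {M : Type*} [TopologicalSpace M] [ChartedSpace (Model k q) M]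

/-- A tangential 2-form is tangentially smooth. -/
def TSmoothTwoForm (η : TwoForm k M) : Prop :=
  ∀ U : Set M, IsOpen U → ∀ X Y : (∀ x : M, FoliationBundle k x),
    TSmoothVectorFieldOn k q X U → TSmoothVectorFieldOn k q Y U →
    TSmoothOn k q (fun x => η x ![X x, Y x]) U

/-- A tangential 2-form is `d_τ`-closed; `d_τ` is given by the Koszul formula. -/
def TClosed (η : TwoForm k M) : Prop :=
  ∀ U : Set M, IsOpen U → ∀ X Y Z : (∀ x : M, FoliationBundle k x),
    TSmoothVectorFieldOn k q X U → TSmoothVectorFieldOn k q Y U →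
    TSmoothVectorFieldOn k q Z U → ∀ x ∈ U,
      leafDeriv k q (fun y => η y ![Y y, Z y]) x (X x)
      - leafDeriv k q (fun y => η y ![X y, Z y]) x (Y x)
      + leafDeriv k q (fun y => η y ![X y, Y y]) x (Z x)
      - η x ![leafBracket k q X Y x, Z x]
      + η x ![leafBracket k q X Z x, Y x]
      - η x ![leafBracket k q Y Z x, X x] = 0

variable (M) in
/-- The complex foliated manifold `M` has a tangential Kähler form. -/
def IsKahlerFoliated : Prop :=
  ∃ η : TwoForm k M, TSmoothTwoForm k q η ∧ IsPositiveOneOne η ∧ TClosed k q η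

end Kahler

/-! ### Tangential holomorphic line bundles -/

section LineBundle

variable (k q : ℕ) {M : Type*} [TopologicalSpace M] [ChartedSpace (Model k q) M]
  (E : M → Type*) [TopologicalSpace (TotalSpace ℂ E)]
  [∀ x, AddCommGroup (E x)] [∀ x, Module ℂ (E x)] [∀ x, TopologicalSpace (E x)]
  [FiberBundle ℂ E]

/-- A complex line bundle is a tangential holomorphic line bundle if the transition functions of its
trivializations are tangentially smooth and holomorphic along the leaves. -/
def IsTangentialHolomorphic [VectorBundle ℂ ℂ E] : Prop :=
  ∀ (e e' : Trivialization ℂ (TotalSpace.proj : TotalSpace ℂ E → M))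
    [MemTrivializationAtlas e] [MemTrivializationAtlas e'],
    TSmoothOn k q (fun x => e.coordChangeL ℂ e' x 1) (e.baseSet ∩ e'.baseSet) ∧
    ∀ x ∈ e.baseSet ∩ e'.baseSet, ∀ v : FoliationBundle k x,
      zeroOnePart (leafDeriv k q (fun y => e.coordChangeL ℂ e' y 1) x).toLinearMap v = 0

variable {E}

/-- A section of `E` is tangentially smooth on the open set `U`. -/
def TSmoothSectionOn (s : ∀ x, E x) (U : Set M) : Prop :=
  ∀ (e : Trivialization ℂ (TotalSpace.proj : TotalSpace ℂ E → M)) [MemTrivializationAtlas e],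
    TSmoothOn k q (fun x => (e ⟨x, s x⟩).2) (U ∩ e.baseSet)

/-- The value at `x` of the `E`-valued tangential `(0,1)`-form `∂̄_τ s`, computed in the preferred
trivialization at `x`. -/
def dbar (s : ∀ x, E x) (x : M) (v : FoliationBundle k x) : E x :=
  (trivializationAt ℂ E x).symm x
    (zeroOnePart
      (leafDeriv k q (fun y => (trivializationAt ℂ E x ⟨y, s y⟩).2) x).toLinearMap v)

/-- `∂̄_τ`-holomorphic sections of `E` over `M`. -/
def IsTangentiallyHolomorphicSection (s : ∀ x, E x) : Prop :=
  TSmoothSectionOn k q s univ ∧ ∀ x, ∀ v : FoliationBundle k x, dbar k q s x v = 0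

variable (E)

/-- A tangentially smooth Hermitian metric on `E`, conjugate linear in the first variable. -/
structure HermitianMetric where
  inner : ∀ x, E x →ₗ⋆[ℂ] E x →ₗ[ℂ] ℂ
  conj_symm : ∀ x (a b : E x), starRingEnd ℂ (inner x b a) = inner x a b
  pos : ∀ x (a : E x), a ≠ 0 → 0 < (inner x a a).re
  smooth : ∀ U : Set M, IsOpen U → ∀ s s' : (∀ x, E x),
    TSmoothSectionOn k q s U → TSmoothSectionOn k q s' U →
    TSmoothOn k q (fun x => inner x (s x) (s' x)) U

/-- A tangential connection on `E`; `toFun s x v` is `∇_v s` at `x`. As usual for local operators,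
it is defined on all sections, but the axioms concern sections that are tangentially smooth
on an open set only. -/
structure TangentialConnection where
  toFun : (∀ x, E x) → ∀ x, FoliationBundle k x →ₗ[ℝ] E x
  add : ∀ U : Set M, IsOpen U → ∀ s s' : (∀ x, E x),
    TSmoothSectionOn k q s U → TSmoothSectionOn k q s' U →
    ∀ x ∈ U, toFun (fun y => s y + s' y) x = toFun s x + toFun s' x
  leibniz : ∀ U : Set M, IsOpen U → ∀ (f : M → ℂ) (s : ∀ x, E x),
    TSmoothOn k q f U → TSmoothSectionOn k q s U → ∀ x ∈ U, ∀ v : FoliationBundle k x,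
      toFun (fun y => f y • s y) x v = f x • toFun s x v + leafDeriv k q f x v • s x
  smooth : ∀ U : Set M, IsOpen U → ∀ (X : ∀ x : M, FoliationBundle k x) (s : ∀ x, E x),
    TSmoothVectorFieldOn k q X U → TSmoothSectionOn k q s U →
    TSmoothSectionOn k q (fun x => toFun s x (X x)) U

variable {E} {k q}

/-- `∇` is the tangential Chern connection of `h`: it is compatible with `h` and its `(0,1)`-part is
`∂̄_τ`. -/
def IsChernConnection (h : HermitianMetric k q E) (D : TangentialConnection k q E) : Prop :=
  (∀ U : Set M, IsOpen U → ∀ s s' : (∀ x, E x),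
    TSmoothSectionOn k q s U → TSmoothSectionOn k q s' U →
    ∀ x ∈ U, ∀ v : FoliationBundle k x,
      leafDeriv k q (fun y => h.inner y (s y) (s' y)) x v =
        h.inner x (D.toFun s x v) (s' x) + h.inner x (s x) (D.toFun s' x v)) ∧
  ∀ U : Set M, IsOpen U → ∀ s : (∀ x, E x), TSmoothSectionOn k q s U →
    ∀ x ∈ U, ∀ v : FoliationBundle k x, zeroOnePart (D.toFun s x) v = dbar k q s x v

/-- The tangential 2-form `Θ` is the curvature of `∇`:
`Θ(X, Y) s = ∇_X ∇_Y s - ∇_Y ∇_X s - ∇_[X,Y] s`. -/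
def IsCurvature (D : TangentialConnection k q E) (Θ : TwoForm k M) : Prop :=
  ∀ U : Set M, IsOpen U → ∀ (X Y : ∀ x : M, FoliationBundle k x) (s : ∀ x, E x),
    TSmoothVectorFieldOn k q X U → TSmoothVectorFieldOn k q Y U → TSmoothSectionOn k q s U →
    ∀ x ∈ U,
      D.toFun (fun y => D.toFun s y (Y y)) x (X x)
        - D.toFun (fun y => D.toFun s y (X y)) x (Y x)
        - D.toFun s x (leafBracket k q X Y x)
      = Θ x ![X x, Y x] • s x

variable (k q E)

/-- `E` is negative: for some Hermitian metric, the curvature `Θ` of the tangential Chern connection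
is such that `-√-1 Θ` is positive definite. -/
def IsNegative : Prop :=
  ∃ (h : HermitianMetric k q E) (D : TangentialConnection k q E) (Θ : TwoForm k M),
    IsChernConnection h D ∧ IsCurvature D Θ ∧
      IsPositiveOneOne (fun x => (-Complex.I) • Θ x : TwoForm k M)

end LineBundle

end TangentialGeometry

end

namespace TangentialGeometry

/-! The proof is a maximum principle along a leaf. The function `|s|²` is continuous on the compact
space `M`, so it has a maximum at some `x₀`; suppose `s x₀ ≠ 0`. Since `∂̄_τ s = 0`, the map `v ↦
∇_v s` is `ℂ`-linear. Vanishing of the first derivative of `|s|²` gives `Re h(s, ∇_v s) = 0`, and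
replacing `v` by `iv` gives `h(s, ∇_v s) = 0`; as `E` has rank one, `∇_v s = 0` at `x₀`. The second
derivative of `|s|²` along a coordinate field `v` is therefore `2 Re h(s, ∇_v ∇_v s)`. Adding the
directions `v` and `iv` turns this into a curvature term, `2 (-iΘ(v, iv)) |s|² > 0`, whereas both
second derivatives are nonpositive at a maximum.

`eq_zero_of_isMax_norm` is this argument. It rests on `fderiv_fderiv_nonpos_of_isLocalMax` and on
the calculus of `coordVectorField`, which provides smooth leafwise fields with vanishing bracket at
`x₀`. -/

/-! ### Slicewise smoothness on the model. -/

theorem sliceSmoothOn_of_contDiffOn {k q : ℕ} {V : Type*} [NormedAddCommGroup V] [NormedSpace ℝ V]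
    {g : Model k q → V} {W : Set (Model k q)} (hW : IsOpen W) (hg : ContDiffOn ℝ ∞ g W) :
    SliceSmoothOn k q g W := by
  have hat : ∀ p ∈ W, ContDiffAt ℝ ∞ g p := fun p hp => hg.contDiffAt (hW.mem_nhds hp)
  refine ⟨fun p hp => ?_, fun m => ?_⟩
  · exact (hat p hp).comp p.1 (f := fun z => (z, p.2)) (contDiffAt_id.prodMk contDiffAt_const)
  · let L : EuclideanSpace ℂ (Fin k) →L[ℝ] Model k q := ContinuousLinearMap.inl ℝ _ _
    have key : ∀ p ∈ W, iteratedFDeriv ℝ m (fun z => g (z, p.2)) p.1 =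
        (iteratedFDerivWithin ℝ m g W p).compContinuousLinearMap fun _ => L := by
      intro p hp
      -- Translating by `a` replaces the affine slice inclusion by the linear map `L`, for which the
      -- chain rule for iterated derivatives is available.
      let a : Model k q := (0, p.2)
      let g' : Model k q → V := fun x => g (x + a)
      let W' : Set (Model k q) := (fun x => x + a) ⁻¹' W
      have hW' : IsOpen W' := hW.preimage (by fun_prop)
      have hg' : ContDiffOn ℝ ∞ g' W' :=
        hg.comp (contDiff_id.add contDiff_const).contDiffOn fun x hx => hx
      have hLp : L p.1 + a = p := by simp [L, a]
      have hmem : L p.1 ∈ W' := by simpa [W', hLp] using hp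
      have hLW : IsOpen (L ⁻¹' W') := hW'.preimage L.continuous
      have h1 := L.iteratedFDerivWithin_comp_right hg' hW'.uniqueDiffOn hLW.uniqueDiffOn hmem
        (i := m) (by exact_mod_cast le_top)
      rw [iteratedFDerivWithin_of_isOpen m hLW hmem, iteratedFDerivWithin_of_isOpen m hW' hmem,
        iteratedFDeriv_comp_add_right, hLp] at h1
      rw [iteratedFDerivWithin_of_isOpen m hW hp, ← h1]
      congr 1
      funext z
      simp [g', L, a]
    refine ContinuousOn.congr ?_ key
    exact (ContinuousMultilinearMap.compContinuousLinearMapL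
      (fun _ : Fin m => L)).continuous.comp_continuousOn
        (hg.continuousOn_iteratedFDerivWithin (by exact_mod_cast le_top) hW.uniqueDiffOn)

theorem SliceSmoothOn.mono {k q : ℕ} {V : Type*} [NormedAddCommGroup V] [NormedSpace ℝ V]
    {g : Model k q → V} {W W' : Set (Model k q)} (hg : SliceSmoothOn k q g W) (h : W' ⊆ W) :
    SliceSmoothOn k q g W' :=
  ⟨fun p hp => hg.1 p (h hp), fun m => (hg.2 m).mono h⟩

theorem SliceSmoothOn.congr {k q : ℕ} {V : Type*} [NormedAddCommGroup V] [NormedSpace ℝ V]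
    {g g' : Model k q → V} {W : Set (Model k q)} (hg : SliceSmoothOn k q g W) (hW : IsOpen W)
    (h : ∀ p ∈ W, g' p = g p) : SliceSmoothOn k q g' W := by
  have hev : ∀ p ∈ W, (fun z => g' (z, p.2)) =ᶠ[𝓝 p.1] fun z => g (z, p.2) := by
    intro p hp
    have hc : ContinuousAt (fun z : EuclideanSpace ℂ (Fin k) => (z, p.2)) p.1 := by fun_prop
    filter_upwards [hc.preimage_mem_nhds (hW.mem_nhds hp)] with z hz using h _ hz
  exact ⟨fun p hp => (hg.1 p hp).congr_of_eventuallyEq (hev p hp),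
    fun m => (hg.2 m).congr fun p hp => ((hev p hp).iteratedFDeriv ℝ m).eq_of_nhds⟩

theorem SliceSmoothOn.continuousOn {k q : ℕ} {V : Type*} [NormedAddCommGroup V] [NormedSpace ℝ V]
    {g : Model k q → V} {W : Set (Model k q)} (hg : SliceSmoothOn k q g W) : ContinuousOn g W := by
  have h := (continuousMultilinearCurryFin0 ℝ (EuclideanSpace ℂ (Fin k)) V).continuous
    |>.comp_continuousOn (hg.2 0)
  refine h.congr fun p _ => ?_
  simp

theorem isOpen_target_inter {k q : ℕ} {M : Type*} [TopologicalSpace M]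
    (φ : OpenPartialHomeomorph M (Model k q)) {U : Set M}
    (hU : IsOpen U) : IsOpen (φ.target ∩ φ.symm ⁻¹' U) :=
  φ.isOpen_inter_preimage_symm hU

/-! ### Leafwise calculus in foliated charts. -/

section Chart

variable {k q : ℕ} {M : Type*} [TopologicalSpace M]

/-- The leafwise complex derivative of the change of foliated coordinates from `φ` to `ψ`. -/
noncomputable def transitionDeriv (φ ψ : OpenPartialHomeomorph M (Model k q)) (p : Model k q) :
    EuclideanSpace ℂ (Fin k) →L[ℂ] EuclideanSpace ℂ (Fin k) :=
  fderiv ℂ (fun z => (ψ (φ.symm (z, p.2))).1) p.1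

theorem transitionDeriv_self {φ : OpenPartialHomeomorph M (Model k q)} {y : M}
    (hyφ : y ∈ φ.source) (v : EuclideanSpace ℂ (Fin k)) :
    transitionDeriv φ φ (φ y) v = v := by
  have : (fun z => (φ (φ.symm (z, (φ y).2))).1) =ᶠ[𝓝 (φ y).1] fun z => z := by
    have hc : ContinuousAt (fun z : EuclideanSpace ℂ (Fin k) => (z, (φ y).2)) (φ y).1 := by
      fun_prop
    filter_upwards [hc.preimage_mem_nhds (φ.open_target.mem_nhds (φ.map_source hyφ))] with z hz
    rw [φ.right_inv hz]
  rw [transitionDeriv, this.fderiv_eq]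
  simp

variable [ChartedSpace (Model k q) M]

theorem TSmoothOn.mono {V : Type*} [NormedAddCommGroup V] [NormedSpace ℝ V] {f : M → V}
    {U U' : Set M} (hf : TSmoothOn k q f U) (h : U' ⊆ U) : TSmoothOn k q f U' :=
  fun φ hφ => (hf φ hφ).mono (inter_subset_inter_right _ (preimage_mono h))

theorem tSmoothOn_const {V : Type*} [NormedAddCommGroup V] [NormedSpace ℝ V] (c : V)
    {U : Set M} (hU : IsOpen U) : TSmoothOn k q (fun _ : M => c) U :=
  fun φ _ => sliceSmoothOn_of_contDiffOn (isOpen_target_inter φ hU) contDiffOn_const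

/-- The order-zero condition gives continuity in the transverse directions too, which is what a
compactness argument on `M` needs. -/
theorem TSmoothOn.continuous {V : Type*} [NormedAddCommGroup V] [NormedSpace ℝ V] {f : M → V}
    (hf : TSmoothOn k q f univ) : Continuous f := by
  rw [continuous_iff_continuousAt]
  intro x
  let φ := chartAt (Model k q) x
  have hx : x ∈ φ.source := mem_chart_source _ x
  have h := (hf φ (chart_mem_atlas _ x)).continuousOn
  rw [preimage_univ, inter_univ] at h
  have h2 : ContinuousAt (f ∘ φ.symm ∘ φ) x :=
    (h.continuousAt (φ.open_target.mem_nhds (φ.map_source hx))).comp (φ.continuousAt hx)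
  refine h2.congr ?_
  filter_upwards [φ.open_source.mem_nhds hx] with y hy
  simp [φ.left_inv hy]

/-- A tangentially smooth function is smooth along the slices of a foliated chart. -/
theorem TSmoothOn.contDiffAt_slice {V : Type*} [NormedAddCommGroup V] [NormedSpace ℝ V]
    {f : M → V} {U : Set M} (hf : TSmoothOn k q f U) {φ : OpenPartialHomeomorph M (Model k q)}
    (hφ : φ ∈ atlas (Model k q) M) {p : Model k q} (hp : p ∈ φ.target) (hpU : φ.symm p ∈ U) :
    ContDiffAt ℝ ∞ (fun z => f (φ.symm (z, p.2))) p.1 :=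
  (hf φ hφ).1 p ⟨hp, hpU⟩

/-- The vector field tangent to the leaves that is constant in the coordinates of `φ`. -/
noncomputable def coordVectorField (φ : OpenPartialHomeomorph M (Model k q))
    (v : EuclideanSpace ℂ (Fin k)) (y : M) : FoliationBundle k y :=
  transitionDeriv φ (chartAt (Model k q) y) (φ y) v

theorem coordVectorField_smul (φ : OpenPartialHomeomorph M (Model k q)) (c : ℂ)
    (v : EuclideanSpace ℂ (Fin k)) (y : M) :
    coordVectorField φ (c • v) y = c • coordVectorField φ v y :=
  map_smul _ c v

theorem leafDeriv_const {V : Type*} [NormedAddCommGroup V] [NormedSpace ℝ V] (c : V) (x : M) :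
    leafDeriv k q (fun _ : M => c) x = 0 := by
  simp [leafDeriv]

theorem leafDeriv_eq_zero_of_eqOn_source {V : Type*} [NormedAddCommGroup V] [NormedSpace ℝ V]
    {f : M → V} {x : M} {c : V} (hf : ∀ y ∈ (chartAt (Model k q) x).source, f y = c) :
    leafDeriv k q f x = 0 := by
  set φ := chartAt (Model k q) x with hφ
  have : (fun z => f (φ.symm (z, (φ x).2))) =ᶠ[𝓝 (φ x).1] fun _ => c := by
    have hc : ContinuousAt (fun z : EuclideanSpace ℂ (Fin k) => (z, (φ x).2)) (φ x).1 := by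
      fun_prop
    filter_upwards [hc.preimage_mem_nhds
      (φ.open_target.mem_nhds (φ.map_source (mem_chart_source _ x)))] with z hz
    exact hf _ (φ.map_target hz)
  rw [leafDeriv, ← hφ, this.fderiv_eq]
  simp

variable [HasGroupoid M (complexFoliationGroupoid k q)]
  {φ ψ χ : OpenPartialHomeomorph M (Model k q)}

theorem transition_property (hφ : φ ∈ atlas (Model k q) M) (hψ : ψ ∈ atlas (Model k q) M) :
    (complexFoliationPregroupoid k q).property (ψ ∘ φ.symm) (φ.target ∩ φ.symm ⁻¹' ψ.source) := by
  have h := HasGroupoid.compatible (G := complexFoliationGroupoid k q) hφ hψ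
  have h1 := (mem_groupoid_of_pregroupoid.1 h).1
  simpa [OpenPartialHomeomorph.trans_source] using h1

/-- A real derivative that is `ℂ`-linear is a complex derivative, so the map `A` supplied by the
pregroupoid must be `transitionDeriv`. -/
theorem transition_hasFDerivAt_and_eq (hφ : φ ∈ atlas (Model k q) M)
    (hψ : ψ ∈ atlas (Model k q) M) {p : Model k q} (hp : p ∈ φ.target)
    (hpψ : φ.symm p ∈ ψ.source) :
    HasFDerivAt (𝕜 := ℂ) (fun z => (ψ (φ.symm (z, p.2))).1) (transitionDeriv φ ψ p) p.1 ∧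
    ∀ v, fderiv ℝ (ψ ∘ φ.symm) p (v, 0) = (transitionDeriv φ ψ p v, 0) := by
  obtain ⟨hs, hA⟩ := transition_property hφ hψ
  obtain ⟨A, hA⟩ := hA p ⟨hp, hpψ⟩
  have hd : HasFDerivAt (ψ ∘ φ.symm) (fderiv ℝ (ψ ∘ φ.symm) p) p :=
    ((hs.contDiffAt ((isOpen_target_inter φ ψ.open_source).mem_nhds ⟨hp, hpψ⟩)).differentiableAt
      (by simp)).hasFDerivAt
  have h2 : HasFDerivAt (fun z => (ψ (φ.symm (z, p.2))).1)
      ((ContinuousLinearMap.fst ℝ _ _).comp ((fderiv ℝ (ψ ∘ φ.symm) p).comp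
        (ContinuousLinearMap.inl ℝ (EuclideanSpace ℂ (Fin k)) (EuclideanSpace ℝ (Fin q))))) p.1 :=
    (ContinuousLinearMap.fst ℝ (EuclideanSpace ℂ (Fin k))
      (EuclideanSpace ℝ (Fin q))).hasFDerivAt.comp p.1
      (HasFDerivAt.comp p.1 (f := fun z => (z, p.2)) (g := ψ ∘ φ.symm) hd
        (hasFDerivAt_prodMk_left p.1 p.2))
  have h3 : HasFDerivAt (𝕜 := ℂ) (fun z => (ψ (φ.symm (z, p.2))).1) A p.1 := by
    refine hasFDerivAt_of_restrictScalars ℝ h2 ?_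
    ext v : 1
    simp [hA]
  have h4 : transitionDeriv φ ψ p = A := h3.fderiv
  rw [h4]
  exact ⟨h3, hA⟩

/-- The transverse coordinate has zero derivative in the plaque directions, hence is constant on a
ball of the slice. -/
theorem transition_snd_eventually_eq (hφ : φ ∈ atlas (Model k q) M)
    (hψ : ψ ∈ atlas (Model k q) M) {p : Model k q} (hp : p ∈ φ.target)
    (hpψ : φ.symm p ∈ ψ.source) :
    ∀ᶠ z in 𝓝 p.1, φ.symm (z, p.2) ∈ ψ.source ∧
      (ψ (φ.symm (z, p.2))).2 = (ψ (φ.symm p)).2 := by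
  have hW := isOpen_target_inter φ ψ.open_source
  have hc : Continuous fun z : EuclideanSpace ℂ (Fin k) => (z, p.2) := by fun_prop
  obtain ⟨r, hr, hball⟩ := Metric.isOpen_iff.1 (hW.preimage hc) p.1 ⟨hp, hpψ⟩
  have hd : ∀ z ∈ Metric.ball p.1 r, HasFDerivAt (𝕜 := ℝ) (fun z => (ψ (φ.symm (z, p.2))).2)
      (0 : EuclideanSpace ℂ (Fin k) →L[ℝ] EuclideanSpace ℝ (Fin q)) z := by
    intro z hz
    have hz' := hball hz
    have hA := (transition_hasFDerivAt_and_eq hφ hψ hz'.1 hz'.2).2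
    have hd : HasFDerivAt (ψ ∘ φ.symm) (fderiv ℝ (ψ ∘ φ.symm) (z, p.2)) (z, p.2) :=
      (((transition_property hφ hψ).1.contDiffAt (hW.mem_nhds hz')).differentiableAt
        (by simp)).hasFDerivAt
    have h2 := (ContinuousLinearMap.snd ℝ _ _).hasFDerivAt.comp z
      (HasFDerivAt.comp z (f := fun z => (z, p.2)) (g := ψ ∘ φ.symm) hd
        (hasFDerivAt_prodMk_left z p.2))
    refine h2.congr_fderiv ?_
    ext1 v
    simp [hA]
  filter_upwards [Metric.ball_mem_nhds p.1 hr] with z hz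
  refine ⟨(hball hz).2, ?_⟩
  exact Metric.isOpen_ball.is_const_of_fderiv_eq_zero (𝕜 := ℝ)
    (convex_ball p.1 r).isPreconnected
    (fun x hx => (hd x hx).differentiableAt.differentiableWithinAt)
    (fun x hx => (hd x hx).fderiv) hz (Metric.mem_ball_self hr)

/-- The chain rule along the leaves for a change of foliated coordinates. -/
theorem hasFDerivAt_slice_of_chart {V : Type*} [NormedAddCommGroup V] [NormedSpace ℝ V]
    {f : M → V} {L : EuclideanSpace ℂ (Fin k) →L[ℝ] V} (hφ : φ ∈ atlas (Model k q) M)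
    (hψ : ψ ∈ atlas (Model k q) M) {y : M} (hyφ : y ∈ φ.source) (hyψ : y ∈ ψ.source)
    (hf : HasFDerivAt (fun z => f (ψ.symm (z, (ψ y).2))) L (ψ y).1) :
    HasFDerivAt (fun z => f (φ.symm (z, (φ y).2)))
      (L.comp ((transitionDeriv φ ψ (φ y)).restrictScalars ℝ)) (φ y).1 := by
  have hp := φ.map_source hyφ
  have hpψ : φ.symm (φ y) ∈ ψ.source := by rwa [φ.left_inv hyφ]
  have h1 := (transition_hasFDerivAt_and_eq hφ hψ hp hpψ).1.restrictScalars ℝ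
  have h2 : HasFDerivAt (fun z => f (ψ.symm (z, (ψ y).2))) L
      ((fun z => (ψ (φ.symm (z, (φ y).2))).1) (φ y).1) := by
    simpa [φ.left_inv hyφ] using hf
  refine (h2.comp (φ y).1 h1).congr_of_eventuallyEq ?_
  filter_upwards [transition_snd_eventually_eq hφ hψ hp hpψ] with z hz
  have : (ψ y).2 = (ψ (φ.symm (z, (φ y).2))).2 := by rw [hz.2, φ.left_inv hyφ]
  simp [this, ψ.left_inv hz.1]

theorem transitionDeriv_comp (hφ : φ ∈ atlas (Model k q) M) (hψ : ψ ∈ atlas (Model k q) M)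
    (hχ : χ ∈ atlas (Model k q) M) {y : M} (hyφ : y ∈ φ.source) (hyψ : y ∈ ψ.source)
    (hyχ : y ∈ χ.source) (v : EuclideanSpace ℂ (Fin k)) :
    transitionDeriv ψ χ (ψ y) (transitionDeriv φ ψ (φ y) v) = transitionDeriv φ χ (φ y) v := by
  have hpχ : φ.symm (φ y) ∈ χ.source := by rwa [φ.left_inv hyφ]
  have hψχ : ψ.symm (ψ y) ∈ χ.source := by rwa [ψ.left_inv hyψ]
  have h1 := (transition_hasFDerivAt_and_eq hφ hχ (φ.map_source hyφ) hpχ).1.restrictScalars ℝ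
  have h2 := (transition_hasFDerivAt_and_eq hψ hχ (ψ.map_source hyψ) hψχ).1.restrictScalars ℝ
  have h3 := hasFDerivAt_slice_of_chart (f := fun x => (χ x).1) hφ hψ hyφ hyψ h2
  exact (DFunLike.congr_fun (h1.unique h3) v).symm

theorem leafCoord_coordVectorField (hφ : φ ∈ atlas (Model k q) M)
    (hψ : ψ ∈ atlas (Model k q) M) {y : M} (hyφ : y ∈ φ.source) (hyψ : y ∈ ψ.source)
    (v : EuclideanSpace ℂ (Fin k)) :
    leafCoord k q ψ y (coordVectorField φ v y) = transitionDeriv φ ψ (φ y) v :=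
  transitionDeriv_comp hφ (chart_mem_atlas _ y) hψ hyφ (mem_chart_source _ y) hyψ v

/-- In the chart `ψ` the components are a leafwise complex derivative. Rewriting it as a block of
the full real derivative of the transition map shows that it is jointly smooth. -/
theorem tSmoothVectorFieldOn_coordVectorField (hφ : φ ∈ atlas (Model k q) M)
    (v : EuclideanSpace ℂ (Fin k)) :
    TSmoothVectorFieldOn k q (coordVectorField φ v) φ.source := by
  intro ψ hψ
  have hW := isOpen_target_inter ψ φ.open_source
  have hg : ContDiffOn ℝ ∞ (fun p => (fderiv ℝ (ψ ∘ φ.symm) ((φ ∘ ψ.symm) p) (v, 0)).1)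
      (ψ.target ∩ ψ.symm ⁻¹' φ.source) := by
    have h1 : ContDiffOn ℝ ∞ (fderiv ℝ (ψ ∘ φ.symm)) (φ.target ∩ φ.symm ⁻¹' ψ.source) :=
      (transition_property hφ hψ).1.fderiv_of_isOpen (isOpen_target_inter φ ψ.open_source)
        (by simp)
    have h2 := h1.comp (transition_property hψ hφ).1 (by
      rintro p ⟨hp, hpφ⟩
      refine ⟨φ.map_source hpφ, ?_⟩
      simp only [mem_preimage, Function.comp_apply, φ.left_inv hpφ]
      exact ψ.map_target hp)
    exact contDiff_fst.comp_contDiffOn (h2.clm_apply contDiffOn_const)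
  refine (sliceSmoothOn_of_contDiffOn hW hg).congr hW ?_
  rintro p ⟨hp, hpφ⟩
  have hpψ := ψ.map_target hp
  rw [leafCoord_coordVectorField hφ hψ hpφ hpψ, Function.comp_apply,
    (transition_hasFDerivAt_and_eq hφ hψ (φ.map_source hpφ)
      (by rwa [φ.left_inv hpφ])).2]

/-- The derivative of `f` along a coordinate vector field of `φ` is computed in the chart `φ`. -/
theorem leafDeriv_coordVectorField {V : Type*} [NormedAddCommGroup V] [NormedSpace ℝ V]
    {f : M → V} {U : Set M} (hf : TSmoothOn k q f U) (hφ : φ ∈ atlas (Model k q) M) {y : M}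
    (hyφ : y ∈ φ.source) (hyU : y ∈ U) (v : EuclideanSpace ℂ (Fin k)) :
    leafDeriv k q f y (coordVectorField φ v y) =
      fderiv ℝ (fun z => f (φ.symm (z, (φ y).2))) (φ y).1 v := by
  have hy := mem_chart_source (Model k q) y
  have h1 := (hf.contDiffAt_slice (chart_mem_atlas _ y) ((chartAt (Model k q) y).map_source hy)
    (by rwa [(chartAt (Model k q) y).left_inv hy])).differentiableAt (by simp)
  rw [(hasFDerivAt_slice_of_chart hφ (chart_mem_atlas _ y) hyφ hy h1.hasFDerivAt).fderiv]
  rfl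

/-- Both fields have constant components in the chart used to compute the bracket. -/
theorem leafBracket_coordVectorField (x : M) (v w : EuclideanSpace ℂ (Fin k)) :
    leafBracket k q (coordVectorField (chartAt (Model k q) x) v)
      (coordVectorField (chartAt (Model k q) x) w) x = 0 := by
  have h : ∀ u : EuclideanSpace ℂ (Fin k), leafDeriv k q (fun y =>
      leafCoord k q (chartAt (Model k q) x) y (coordVectorField (chartAt (Model k q) x) u y)) x
        = 0 :=
    fun u => leafDeriv_eq_zero_of_eqOn_source (c := u) fun y hy => by
      rw [leafCoord_coordVectorField (chart_mem_atlas _ x) (chart_mem_atlas _ x) hy hy,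
        transitionDeriv_self hy]
  rw [leafBracket, h, h]
  simp

end Chart

/-! ### The second derivative test. -/

theorem fderiv_fderiv_nonpos_of_isLocalMax {F : Type*} [NormedAddCommGroup F] [NormedSpace ℝ F]
    {u : F → ℝ} {z : F} (hmax : IsLocalMax u z) (hu : ContDiffAt ℝ 2 u z) (v : F) :
    fderiv ℝ (fun x => fderiv ℝ u x v) z v ≤ 0 := by
  let l : ℝ → F := fun r => z + r • v
  have hl : ∀ r, HasDerivAt l v r := fun r =>
    (((hasDerivAt_id r).smul_const v).const_add z).congr_deriv (one_smul ℝ v)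
  have hl0 : l 0 = z := by simp [l]
  have hlt : Filter.Tendsto l (𝓝 0) (𝓝 z) := hl0 ▸ (hl 0).continuousAt
  have hd : ∀ᶠ x in 𝓝 z, DifferentiableAt ℝ u x :=
    (hu.eventually (by simp)).mono fun x hx => hx.differentiableAt (by simp)
  have hderiv : deriv (u ∘ l) =ᶠ[𝓝 0] fun r => fderiv ℝ u (l r) v := by
    filter_upwards [hlt.eventually hd] with r hr
    exact (hr.hasFDerivAt.comp_hasDerivAt r (hl r)).deriv
  have hd2 : DifferentiableAt ℝ (fun x => fderiv ℝ u x v) z :=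
    ((hu.fderiv_right (m := 1) (by norm_num)).differentiableAt (by simp)).clm_apply
      (differentiableAt_const v)
  have hdd : deriv (deriv (u ∘ l)) 0 = fderiv ℝ (fun x => fderiv ℝ u x v) z v := by
    rw [hderiv.deriv_eq]
    have h : HasFDerivAt (fun x => fderiv ℝ u x v) (fderiv ℝ (fun x => fderiv ℝ u x v) z) (l 0) :=
      hl0.symm ▸ hd2.hasFDerivAt
    exact (h.comp_hasDerivAt 0 (hl 0)).deriv
  have hmaxl : IsLocalMax (u ∘ l) 0 := by
    simpa [IsLocalMax, IsMaxFilter, hl0] using hlt.eventually hmax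
  by_contra! hpos
  -- A positive second derivative would make `0` a local minimum as well, so `u ∘ l` would be
  -- locally constant with second derivative zero.
  have hminl : IsLocalMin (u ∘ l) 0 := by
    refine isLocalMin_of_deriv_deriv_pos (by rw [hdd]; exact hpos) hmaxl.deriv_eq_zero ?_
    exact ContinuousAt.comp (by rw [hl0]; exact hu.continuousAt) (hl 0).continuousAt
  have hconst : u ∘ l =ᶠ[𝓝 0] fun _ => (u ∘ l) 0 := by
    filter_upwards [hmaxl, hminl] with r h1 h2 using le_antisymm h1 h2
  rw [← hdd, hconst.deriv.deriv_eq] at hpos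
  simp at hpos

/-! ### The maximum principle for sections of a negative line bundle. -/

theorem TSmoothSectionOn.mono {k q : ℕ} {M : Type*} [TopologicalSpace M]
    [ChartedSpace (Model k q) M] {E : M → Type*}
    [TopologicalSpace (TotalSpace ℂ E)] [∀ x, AddCommGroup (E x)] [∀ x, TopologicalSpace (E x)]
    [FiberBundle ℂ E] {s : ∀ x, E x} {U U' : Set M} (hs : TSmoothSectionOn k q s U)
    (h : U' ⊆ U) : TSmoothSectionOn k q s U' :=
  fun e _ => TSmoothOn.mono (hs e) (inter_subset_inter_left _ h)

section LineBundle

variable {k q : ℕ} {M : Type*} [TopologicalSpace M] [ChartedSpace (Model k q) M]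
  {E : M → Type*} [TopologicalSpace (TotalSpace ℂ E)]
  [∀ x, AddCommGroup (E x)] [∀ x, Module ℂ (E x)] [∀ x, TopologicalSpace (E x)]
  [FiberBundle ℂ E]

/-- The `(0,1)`-part of `∇s` is `∂̄_τ s = 0`, so only the `ℂ`-linear part remains. -/
theorem toFun_I_smul_of_holomorphic {h : HermitianMetric k q E} {D : TangentialConnection k q E}
    (hD : IsChernConnection h D) {s : ∀ x, E x} (hs : IsTangentiallyHolomorphicSection k q s)
    (x : M) (v : FoliationBundle k x) :
    D.toFun s x (Complex.I • v) = Complex.I • D.toFun s x v := by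
  have h0 := hD.2 univ isOpen_univ s hs.1 x (mem_univ x) v
  rw [hs.2 x v, zeroOnePart, smul_eq_zero] at h0
  have h1 := congrArg (Complex.I • ·) (h0.resolve_left (by norm_num))
  simp only [smul_add, smul_smul, Complex.I_mul_I, smul_zero, neg_smul, one_smul] at h1
  exact (add_neg_eq_zero.1 h1).symm

theorem toFun_const_smul (D : TangentialConnection k q E) {U : Set M} (hU : IsOpen U) (c : ℂ)
    {s : ∀ x, E x} (hs : TSmoothSectionOn k q s U) {x : M} (hx : x ∈ U) (v : FoliationBundle k x) :
    D.toFun (fun y => c • s y) x v = c • D.toFun s x v := by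
  have h := D.leibniz U hU (fun _ => c) s (tSmoothOn_const c hU) hs x hx v
  simpa [leafDeriv_const] using h

theorem HermitianMetric.inner_self (h : HermitianMetric k q E) (x : M) (a : E x) :
    h.inner x a a = ((h.inner x a a).re : ℂ) :=
  (Complex.conj_eq_iff_real.1 (h.conj_symm x a a)).elim fun r hr => by rw [hr]; simp

variable [HasGroupoid M (complexFoliationGroupoid k q)]

theorem eq_zero_of_isMax_norm [VectorBundle ℂ ℂ E] (hk : 0 < k) {h : HermitianMetric k q E}
    {D : TangentialConnection k q E} {Θ : TwoForm k M} (hD : IsChernConnection h D)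
    (hΘ : IsCurvature D Θ) (hpos : IsPositiveOneOne (fun x => (-Complex.I) • Θ x : TwoForm k M))
    {s : ∀ x, E x} (hs : IsTangentiallyHolomorphicSection k q s) {x : M}
    (hx : ∀ y, (h.inner y (s y) (s y)).re ≤ (h.inner x (s x) (s x)).re) : s x = 0 := by
  by_contra hsx
  set φ := chartAt (Model k q) x with hφdef
  have hφ : φ ∈ atlas (Model k q) M := chart_mem_atlas _ x
  have hxφ : x ∈ φ.source := mem_chart_source _ x
  have hU := φ.open_source
  have hsU : TSmoothSectionOn k q s φ.source := hs.1.mono (subset_univ _)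
  let X : EuclideanSpace ℂ (Fin k) → ∀ y : M, FoliationBundle k y := fun w => coordVectorField φ w
  have hX : ∀ w, TSmoothVectorFieldOn k q (X w) φ.source :=
    tSmoothVectorFieldOn_coordVectorField hφ
  have hXx : ∀ w, X w x = w := fun w => transitionDeriv_self hxφ w
  let Ds : EuclideanSpace ℂ (Fin k) → ∀ y : M, E y := fun w y => D.toFun s y (X w y)
  have hDs : ∀ w, TSmoothSectionOn k q (Ds w) φ.source :=
    fun w => D.smooth _ hU _ _ (hX w) hsU
  have hDsI : ∀ w, Ds (Complex.I • w) = fun y => Complex.I • Ds w y := by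
    intro w
    funext y
    simp only [Ds, X, coordVectorField_smul]
    exact toFun_I_smul_of_holomorphic hD hs y _
  let H : M → ℂ := fun y => h.inner y (s y) (s y)
  let G : EuclideanSpace ℂ (Fin k) → M → ℂ := fun w y => h.inner y (s y) (Ds w y)
  have hH : TSmoothOn k q H φ.source := h.smooth _ hU _ _ hsU hsU
  have hG : ∀ w, TSmoothOn k q (G w) φ.source := fun w => h.smooth _ hU _ _ hsU (hDs w)
  set p := φ x with hp
  have hpt : p ∈ φ.target := φ.map_source hxφ
  have hpx : φ.symm p = x := φ.left_inv hxφ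
  let ι : EuclideanSpace ℂ (Fin k) → M := fun z => φ.symm (z, p.2)
  have hre : ∀ {f : M → ℂ}, TSmoothOn k q f φ.source → ∀ z, (z, p.2) ∈ φ.target → ∀ w,
      fderiv ℝ (fun z => (f (ι z)).re) z w =
        (leafDeriv k q f (ι z) (X w (ι z))).re := by
    intro f hf z hz w
    have hd := (hf.contDiffAt_slice hφ hz (φ.map_target hz)).differentiableAt (by simp)
    rw [leafDeriv_coordVectorField hf hφ (φ.map_target hz) (φ.map_target hz), φ.right_inv hz]
    exact DFunLike.congr_fun (Complex.reCLM.hasFDerivAt.comp z hd.hasFDerivAt).fderiv w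
  have hdH : ∀ y ∈ φ.source, ∀ w, (leafDeriv k q H y (X w y)).re = 2 * (G w y).re := by
    intro y hy w
    have h1 := hD.1 _ hU s s hsU hsU y hy (X w y)
    have h2 : h.inner y (D.toFun s y (X w y)) (s y) = starRingEnd ℂ (G w y) :=
      (h.conj_symm y _ _).symm
    have h3 : leafDeriv k q H y (X w y) = starRingEnd ℂ (G w y) + G w y := h2 ▸ h1
    rw [h3, Complex.add_re, Complex.conj_re]
    ring
  let u : EuclideanSpace ℂ (Fin k) → ℝ := fun z => (H (ι z)).re
  have hev : ∀ᶠ z in 𝓝 p.1, (z, p.2) ∈ φ.target := by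
    have hc : ContinuousAt (fun z : EuclideanSpace ℂ (Fin k) => (z, p.2)) p.1 := by fun_prop
    exact hc.preimage_mem_nhds (φ.open_target.mem_nhds hpt)
  have hιp : ι p.1 = x := hpx
  have hu : ∀ z, (z, p.2) ∈ φ.target → ∀ w, fderiv ℝ u z w = 2 * (G w (ι z)).re :=
    fun z hz w => (hre hH z hz w).trans (hdH _ (φ.map_target hz) w)
  -- The bound `hx` holds on all of `M`, so the values of `φ.symm` outside its target do no harm.
  have humax : IsLocalMax u p.1 := Filter.Eventually.of_forall fun z => by
    simpa only [u, hιp] using hx (ι z)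
  have huc : ContDiffAt ℝ 2 u p.1 :=
    (Complex.reCLM.contDiff.contDiffAt.comp p.1
      (hH.contDiffAt_slice hφ hpt (φ.map_target hpt))).of_le ENat.LEInfty.out
  have hGre : ∀ w, (G w x).re = 0 := by
    intro w
    have h1 := hu p.1 hpt w
    rw [humax.fderiv_eq_zero, hιp] at h1
    simpa using h1.symm
  have hG0 : ∀ w, G w x = 0 := by
    intro w
    refine Complex.ext (hGre w) ?_
    -- `G (i w) = i G w`, whose real part is minus the imaginary part of `G w`.
    have h1 := hGre (Complex.I • w)
    simpa [G, hDsI] using h1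
  have hHx : 0 < (h.inner x (s x) (s x)).re := h.pos x _ hsx
  have hDs0 : ∀ w, Ds w x = 0 := by
    intro w
    -- Rank one: the nonzero vector `s x` spans the fibre.
    obtain ⟨c, hc⟩ : ∃ c : ℂ, Ds w x = c • s x := by
      let e := (trivializationAt ℂ E x).continuousLinearEquivAt ℂ x
        (FiberBundle.mem_baseSet_trivializationAt' x)
      have hne : e (s x) ≠ 0 := by simpa using hsx
      refine ⟨e (Ds w x) / e (s x), e.injective ?_⟩
      rw [map_smul, smul_eq_mul, div_mul_cancel₀ _ hne]
    have h1 : c * h.inner x (s x) (s x) = 0 := by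
      simpa [G, hc] using hG0 w
    have h2 : h.inner x (s x) (s x) ≠ 0 := fun h0 => by simp [h0] at hHx
    rw [hc, (mul_eq_zero.1 h1).resolve_right h2, zero_smul]
  have hdd : ∀ w, fderiv ℝ (fun z => fderiv ℝ u z w) p.1 w =
      2 * (h.inner x (s x) (D.toFun (Ds w) x w)).re := by
    intro w
    have h1 : (fun z => fderiv ℝ u z w) =ᶠ[𝓝 p.1] fun z => 2 * (G w (ι z)).re :=
      hev.mono fun z hz => hu z hz w
    have h2 : DifferentiableAt ℝ (fun z => (G w (ι z)).re) p.1 :=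
      Complex.reCLM.differentiableAt.comp p.1 (((hG w).contDiffAt_slice hφ hpt
        (φ.map_target hpt)).differentiableAt (by simp))
    have h3 := hD.1 _ hU s (Ds w) hsU (hDs w) x hxφ (X w x)
    have h4 := hre (hG w) p.1 hpt w
    rw [hιp] at h4
    rw [h1.fderiv_eq, fderiv_const_mul h2, smul_apply, h4, smul_eq_mul]
    congr 2
    -- The term `h(∇_w s, ∇_w s)` of the product rule vanishes at `x`.
    rw [hDs0, map_zero, zero_add, hXx] at h3
    rw [hXx]
    exact h3
  obtain ⟨v, hv⟩ : ∃ v : EuclideanSpace ℂ (Fin k), v ≠ 0 :=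
    ⟨EuclideanSpace.single ⟨0, hk⟩ 1, by simp⟩
  have hle1 := fderiv_fderiv_nonpos_of_isLocalMax humax huc v
  have hle2 := fderiv_fderiv_nonpos_of_isLocalMax humax huc (Complex.I • v)
  rw [hdd] at hle1 hle2
  have hcurv := hΘ _ hU (X v) (X (Complex.I • v)) s (hX _) (hX _) hsU x hxφ
  have hbr : leafBracket k q (X v) (X (Complex.I • v)) x = 0 := leafBracket_coordVectorField x _ _
  have e1 : D.toFun (Ds (Complex.I • v)) x v = Complex.I • D.toFun (Ds v) x v := by
    rw [hDsI, toFun_const_smul D hU _ (hDs v) hxφ]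
  have e2 : D.toFun (Ds (Complex.I • v)) x (Complex.I • v) =
      Complex.I • D.toFun (Ds v) x (Complex.I • v) := by
    rw [hDsI, toFun_const_smul D hU _ (hDs v) hxφ]
  have hcurv' : Complex.I • D.toFun (Ds v) x v - D.toFun (Ds v) x (Complex.I • v) =
      Θ x ![v, Complex.I • v] • s x := by
    rw [hbr, map_zero, sub_zero, hXx, hXx] at hcurv
    rw [← e1]
    exact hcurv
  -- Since `∇_{iv} s = i ∇_v s`, multiplying the commutator identity `hcurv'` by `-i` turns it into
  -- the sum of the two pure second derivatives.
  have hkey : D.toFun (Ds v) x v + D.toFun (Ds (Complex.I • v)) x (Complex.I • v) =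
      ((-Complex.I) * Θ x ![v, Complex.I • v]) • s x := by
    rw [mul_smul, ← hcurv', e2, smul_sub, smul_smul, neg_mul, Complex.I_mul_I, neg_neg, one_smul,
      neg_smul, sub_neg_eq_add]
  have hΘpos : 0 < (-Complex.I * Θ x ![v, Complex.I • v]).re := by
    simpa using (hpos x).2.2 v hv
  -- Pairing with `s x` gives a positive right side, against `hle1` and `hle2`.
  have hsum := congrArg (fun a => (h.inner x (s x) a).re) hkey
  simp only [map_add, map_smul, Complex.add_re, smul_eq_mul] at hsum
  rw [h.inner_self x (s x), Complex.re_mul_ofReal] at hsum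
  have := mul_pos hΘpos hHx
  linarith

end LineBundle
end TangentialGeometry

theorem mainTheorem7 (k q : ℕ) (hk : 0 < k)
    {M : Type*} [TopologicalSpace M] [T2Space M] [CompactSpace M]
    [ChartedSpace (TangentialGeometry.Model k q) M]
    [HasGroupoid M (TangentialGeometry.complexFoliationGroupoid k q)]
    (hM : TangentialGeometry.IsKahlerFoliated k q M)
    (E : M → Type*) [TopologicalSpace (Bundle.TotalSpace ℂ E)]
    [∀ x, AddCommGroup (E x)] [∀ x, Module ℂ (E x)] [∀ x, TopologicalSpace (E x)]
    [FiberBundle ℂ E] [VectorBundle ℂ ℂ E]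
    (hE : TangentialGeometry.IsTangentialHolomorphic k q E)
    (hneg : TangentialGeometry.IsNegative k q E)
    (s : ∀ x, E x) (hs : TangentialGeometry.IsTangentiallyHolomorphicSection k q s) :
    ∀ x, s x = 0 := by
  intro x
  obtain ⟨h, D, Θ, hD, hΘ, hpos⟩ := hneg
  have hc : Continuous fun y => (h.inner y (s y) (s y)).re :=
    Complex.continuous_re.comp (h.smooth univ isOpen_univ s s hs.1 hs.1).continuous
  obtain ⟨x₀, -, hx₀⟩ := isCompact_univ.exists_isMaxOn ⟨x, mem_univ x⟩ hc.continuousOn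
  have h0 := TangentialGeometry.eq_zero_of_isMax_norm hk hD hΘ hpos hs fun y => hx₀ (mem_univ y)
  by_contra hsx
  have h1 : (h.inner x (s x) (s x)).re ≤ (h.inner x₀ (s x₀) (s x₀)).re := hx₀ (mem_univ x)
  have h2 := h.pos x _ hsx
  -- The maximum of `|s|²` is zero, contradicting positivity of the metric at `x`.
  simp [h0] at h1
  linarith
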